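/- **Multiple String Matching Problem.** Given a text $t\in\Sigma^n$ and a dictionary $S=(s^1,\dots,s^m)$ of nonempty strings over a finite alphabet $\Sigma=\mathbb Z/q\mathbb Z$, $q\ge 2$, of total length $L=|s^1|+\dots+|s^m|$, determine for every $j\in\{1,\dots,m\}$ the set $I_j$ of all positions $i$ with $t[i:i+|s^j|-1]=s^j$. The lengths $n,|s^1|,\dots,|s^m|$ are known to the algorithm; the $n+L$ symbols of $t$ and $S$ are accessed only by queries. A classical algorithm is a randomized decision tree, each query revealing one symbol; its number of queries is the maximum over all inputs and all coin tosses. A quantum algorithm alternates arbitrary input-independent unitaries on a finite-dimensional space with the query unitary $|i\rangle|z\rangle|w\rangle\mapsto|i\rangle|z+x_i \bmod q\rangle|w\rangle$, where $x_i$ is the $i$-th of the $n+L$ input symbols, and ends with a measurement. An algorithm solves the problem if on every input of the given lengths it outputs $(I_1,\dots,I_m)$ with probability at least $2/3$. **Theorem.** The worst-case query complexity of the Multiple String Matching Problem is $\Omega(n+L)$ classically and $\Omega(n+\sqrt{mL})$ quantumly. Precisely: 1. (Classical.) There is an absolute constant $c>0$ such that for all integers $q\ge2$, $m\ge1$, $n$,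 $L$ with $m\le L\le mn$ there are lengths $\ell_1,\dots,\ell_m\ge1$ with $\ell_1+\dots+\ell_m=L$ such that every classical algorithm which solves the problem for texts of length $n$ and dictionaries with $|s^j|=\ell_j$ makes at least $c\,(n+L)$ queries. 2. (Quantum.) There is an absolute constant $c>0$ such that for all integers $q\ge2$, $m\ge1$, $n$, $L$ with $m\le L\le mn$, and with $m\ge2$ or $L=1$, there are lengths $\ell_1,\dots,\ell_m\ge1$ with $\ell_1+\dots+\ell_m=L$ such that every quantum algorithm which solves the problem for texts of length $n$ and dictionaries with $|s^j|=\ell_j$ makes at least $c\,(n+\sqrt{mL})$ queries. -/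

import Mathlib

/-! ### Classical query algorithms -/

/-- A deterministic query algorithm (decision tree) that accesses an unknown input `x : ι → A`
by querying single symbols `x i`, and finally outputs an element of `O`. -/
inductive DecisionTree (ι A O : Type) : Type
  | output (o : O) : DecisionTree ι A O
  | query (i : ι) (next : A → DecisionTree ι A O) : DecisionTree ι A O

/-- The output of a decision tree on the input `x`. -/
def DecisionTree.run {ι A O : Type} (x : ι → A) : DecisionTree ι A O → O
  | .output o => o
  | .query i next => DecisionTree.run x (next (x i))

/-- The number of queries that a decision tree makes on the input `x`. -/
def DecisionTree.numQueries {ι A O : Type} (x : ι → A) : DecisionTree ι A O → ℕ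
  | .output _ => 0
  | .query i next => DecisionTree.numQueries x (next (x i)) + 1

/-- A randomized (classical) query algorithm: a probability distribution on decision trees. -/
structure RandomizedAlgorithm (ι A O : Type) where
  dist : PMF (DecisionTree ι A O)

/-- On every input, and for every outcome of the coin tosses, at most `T` queries are made. -/
def RandomizedAlgorithm.QueriesAtMost {ι A O : Type} (R : RandomizedAlgorithm ι A O) (T : ℕ) :
    Prop :=
  ∀ D ∈ R.dist.support, ∀ x : ι → A, D.numQueries x ≤ T

/-- On every input `x`, the algorithm outputs `f x` with probability at least `2/3`. -/
def RandomizedAlgorithm.Computes {ι A O : Type} (R : RandomizedAlgorithm ι A O)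
    (f : (ι → A) → O) : Prop :=
  ∀ x : ι → A, 2 / 3 ≤ (R.dist.map (DecisionTree.run x)) (f x)

/-! ### Quantum query algorithms -/

/-- A quantum query algorithm for inputs `x : ι → A`. The computational basis consists of the
states `|i⟩|z⟩|w⟩` with `i : ι` (index register), `z : A` (query output register) and
`w : Fin d` (work space). The algorithm starts in the basis state `start`, applies
`unitary 0`, then alternates queries with `unitary 1, …, unitary numQueries`, then measures in the
computational basis and outputs `decode` of the measured basis element. -/
structure QuantumAlgorithm (ι A O : Type) [Fintype ι] [DecidableEq ι] [Fintype A]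
    [DecidableEq A] where
  d : ℕ
  numQueries : ℕ
  start : ι × A × Fin d
  unitary : ℕ → Matrix.unitaryGroup (ι × A × Fin d) ℂ
  decode : ι × A × Fin d → O

/-- The query unitary `|i⟩|z⟩|w⟩ ↦ |i⟩|z + x i⟩|w⟩`, acting on vectors of amplitudes. -/
def quantumQuery {ι A : Type} [AddCommGroup A] {d : ℕ} (x : ι → A) (ψ : ι × A × Fin d → ℂ) :
    ι × A × Fin d → ℂ :=
  fun b => ψ (b.1, b.2.1 - x b.1, b.2.2)

/-- The state after `k` queries to the input `x` (and the unitary that follows). -/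
def QuantumAlgorithm.state {ι A O : Type} [Fintype ι] [DecidableEq ι] [Fintype A]
    [DecidableEq A] [AddCommGroup A] (Q : QuantumAlgorithm ι A O) (x : ι → A) :
    ℕ → (ι × A × Fin Q.d → ℂ)
  | 0 => Matrix.mulVec (Q.unitary 0).1 (Pi.single Q.start 1)
  | k + 1 => Matrix.mulVec (Q.unitary (k + 1)).1 (quantumQuery x (Q.state x k))

open Classical in
/-- The probability that the final measurement on the input `x` results in the output `o`. -/
noncomputable def QuantumAlgorithm.outputProb {ι A O : Type} [Fintype ι] [DecidableEq ι]
    [Fintype A] [DecidableEq A] [AddCommGroup A] (Q : QuantumAlgorithm ι A O) (x : ι → A)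
    (o : O) : ℝ :=
  ∑ b, if Q.decode b = o then ‖Q.state x Q.numQueries b‖ ^ 2 else 0

/-- On every input `x`, the algorithm outputs `f x` with probability at least `2/3`. -/
def QuantumAlgorithm.Computes {ι A O : Type} [Fintype ι] [DecidableEq ι] [Fintype A]
    [DecidableEq A] [AddCommGroup A] (Q : QuantumAlgorithm ι A O) (f : (ι → A) → O) : Prop :=
  ∀ x : ι → A, 2 / 3 ≤ Q.outputProb x (f x)

/-! ### The Multiple String Matching Problem -/

/-- The query positions of an instance with a text of length `n` and a dictionary of `m` strings
of lengths `len 0, …, len (m - 1)`: the positions of the text and of the dictionary strings. -/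
abbrev MSMIndex (n : ℕ) {m : ℕ} (len : Fin m → ℕ) : Type :=
  Fin n ⊕ ((j : Fin m) × Fin (len j))

/-- The Multiple String Matching Problem: given the text `i ↦ x (inl i)` and the dictionary
strings `k ↦ x (inr ⟨j, k⟩)`, determine for every `j` the set of all (zero-based) positions of
the text at which an occurrence of the `j`-th string starts. -/
def multipleStringMatching {A : Type} (n : ℕ) {m : ℕ} (len : Fin m → ℕ)
    (x : MSMIndex n len → A) : Fin m → Set (Fin n) :=
  fun j => {i | ∀ k : Fin (len j), ∃ h : (i : ℕ) + (k : ℕ) < n,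
    x (Sum.inl ⟨(i : ℕ) + (k : ℕ), h⟩) = x (Sum.inr ⟨j, k⟩)}

/-! Classically, take the all-zero text and strings with every length at most `n`. Everything
matches, and altering any one symbol destroys a match, so the instance is sensitive at all `n + L`
positions. An algorithm that leaves a position unqueried cannot tell the two inputs apart, so each
position is queried with constant probability (`RandomizedAlgorithm.card_le_of_sensitive`).

For quantum algorithms, `adversary_bound` tracks the inner products of final states over a weighted
graph of inputs differing in one symbol. Applied to a product of unstructured searches with at most
one mark per block, it gives `Ω(∑ √|K j|)` (`QuantumAlgorithm.sum_sqrt_card_le`). Against a zero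
text, every string is a block of size `len j`, and balanced lengths yield `√(mL)`. With a one-symbol
string, every text position is a block of size one, which yields `n`. The lengths may be chosen to
suit the larger term. -/

/-! ### Classical sensitivity bound -/

/-- The positions that a decision tree queries on the input `x`, in order. -/
def DecisionTree.queried {ι A O : Type} (x : ι → A) : DecisionTree ι A O → List ι
  | .output _ => []
  | .query i next => i :: DecisionTree.queried x (next (x i))

theorem DecisionTree.length_queried {ι A O : Type} (x : ι → A) (D : DecisionTree ι A O) :
    (D.queried x).length = D.numQueries x := by
  induction D with
  | output o => rfl
  | query i next ih => simp [queried, numQueries, ih]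

theorem DecisionTree.run_congr {ι A O : Type} {x y : ι → A} (D : DecisionTree ι A O)
    (h : ∀ i ∈ D.queried x, x i = y i) : D.run x = D.run y := by
  induction D with
  | output o => rfl
  | query i next ih =>
    simp only [queried, List.mem_cons, forall_eq_or_imp] at h
    simp only [run, ← h.1]
    exact ih _ h.2

/-- If `f` is sensitive at the input `x` to the change of any single symbol, then computing `f`
takes at least a third as many queries as there are symbols. -/
theorem RandomizedAlgorithm.card_le_of_sensitive {ι A O : Type} [Fintype ι]
    (R : RandomizedAlgorithm ι A O) {f : (ι → A) → O} (hf : R.Computes f) {T : ℕ}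
    (hT : R.QueriesAtMost T) (x : ι → A) (y : ι → ι → A)
    (hxy : ∀ i k, k ≠ i → x k = y i k) (hfxy : ∀ i, f x ≠ f (y i)) :
    (Fintype.card ι : ℝ) ≤ 3 * T := by
  classical
  -- A tree not querying `i` on `x` gives the same output on `y i`, so it is right on at most one of
  -- them; other trees count at most twice.
  have key : ∀ i, (4 / 3 : ENNReal) ≤
      1 + ∑' D, (if i ∈ D.queried x then R.dist D else 0) := by
    intro i
    have h1 := hf x
    have h2 := hf (y i)
    rw [PMF.map_apply] at h1 h2
    have h3 : (4 / 3 : ENNReal) = 2 / 3 + 2 / 3 := by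
      rw [ENNReal.div_add_div_same]; norm_num
    rw [h3, ← R.dist.tsum_coe]
    refine (add_le_add h1 h2).trans ?_
    rw [← ENNReal.tsum_add, ← ENNReal.tsum_add]
    refine ENNReal.tsum_le_tsum fun D => ?_
    by_cases hq : i ∈ D.queried x
    · rw [if_pos hq]
      gcongr <;> split_ifs <;> simp
    · have hrun : D.run x = D.run (y i) :=
        D.run_congr fun k hk => hxy i k (by rintro rfl; exact hq hk)
      rw [if_neg hq, add_zero]
      by_cases hx : f x = D.run x
      · rw [if_pos hx, if_neg, add_zero]
        intro h
        exact hfxy i (hx.trans (hrun.trans h.symm))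
      · rw [if_neg hx, zero_add]
        split_ifs <;> simp
  -- The left side is the expected number of distinct positions queried on `x`.
  have hsum : ∑ i : ι, ∑' D, (if i ∈ D.queried x then R.dist D else 0) ≤ (T : ENNReal) := by
    rw [← Summable.tsum_finsetSum fun _ _ => ENNReal.summable]
    calc ∑' D, ∑ i : ι, (if i ∈ D.queried x then R.dist D else 0)
        ≤ ∑' D, (T : ENNReal) * R.dist D := by
          refine ENNReal.tsum_le_tsum fun D => ?_
          rw [← Finset.sum_filter, Finset.sum_const, nsmul_eq_mul]
          by_cases hD : D ∈ R.dist.support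
          · gcongr
            calc (Finset.univ.filter (· ∈ D.queried x)).card
                ≤ (D.queried x).toFinset.card :=
                  Finset.card_le_card fun i hi => by simpa using hi
              _ ≤ (D.queried x).length := List.toFinset_card_le _
              _ = D.numQueries x := D.length_queried x
              _ ≤ T := hT D hD x
          · rw [PMF.mem_support_iff, not_not] at hD
            simp [hD]
      _ = T := by rw [ENNReal.tsum_mul_left, R.dist.tsum_coe, mul_one]
  have htot : (Fintype.card ι : ENNReal) * (4 / 3) ≤ Fintype.card ι + T := by
    calc (Fintype.card ι : ENNReal) * (4 / 3) = ∑ _i : ι, (4 / 3 : ENNReal) := by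
          simp
      _ ≤ ∑ i : ι, (1 + ∑' D, (if i ∈ D.queried x then R.dist D else 0)) :=
          Finset.sum_le_sum fun i _ => key i
      _ ≤ Fintype.card ι + T := by
          rw [Finset.sum_add_distrib]
          gcongr
          simp
  have := ENNReal.toReal_mono (by finiteness) htot
  rw [ENNReal.toReal_mul, ENNReal.toReal_add (by finiteness) (by finiteness)] at this
  simp only [ENNReal.toReal_natCast, ENNReal.toReal_div, ENNReal.toReal_ofNat] at this
  linarith

/-! ### Inner products, unitaries and distinguishability -/

section UnitaryEvolution

/-- Cauchy–Schwarz in its AM–GM form: the free weights `a`, `b` later become the adversary weights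
of the two inputs. -/
theorem norm_sum_star_mul_le {β : Type} (s : Finset β) (φ ψ : β → ℂ) (a b : ℝ) :
    a * b * ‖∑ i ∈ s, star (φ i) * ψ i‖ ≤
      (a ^ 2 * ∑ i ∈ s, ‖φ i‖ ^ 2 + b ^ 2 * ∑ i ∈ s, ‖ψ i‖ ^ 2) / 2 := by
  have h1 : ‖∑ i ∈ s, star (φ i) * ψ i‖ ≤ ∑ i ∈ s, ‖φ i‖ * ‖ψ i‖ :=
    (norm_sum_le _ _).trans_eq (by simp)
  have h2 : |a * b| * ∑ i ∈ s, ‖φ i‖ * ‖ψ i‖ ≤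
      (a ^ 2 * ∑ i ∈ s, ‖φ i‖ ^ 2 + b ^ 2 * ∑ i ∈ s, ‖ψ i‖ ^ 2) / 2 := by
    rw [Finset.mul_sum, Finset.mul_sum, Finset.mul_sum, ← Finset.sum_add_distrib,
      Finset.sum_div]
    refine Finset.sum_le_sum fun i _ => ?_
    rw [abs_mul]
    have := sq_nonneg (|a| * ‖φ i‖ - |b| * ‖ψ i‖)
    rw [← sq_abs a, ← sq_abs b]
    nlinarith
  calc a * b * ‖∑ i ∈ s, star (φ i) * ψ i‖ ≤ |a * b| * ‖∑ i ∈ s, star (φ i) * ψ i‖ := by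
        gcongr; exact le_abs_self _
    _ ≤ |a * b| * ∑ i ∈ s, ‖φ i‖ * ‖ψ i‖ := by gcongr
    _ ≤ _ := h2

variable {β : Type} [Fintype β]

theorem sum_star_mul_self_eq (φ : β → ℂ) :
    ∑ i, star (φ i) * φ i = ((∑ i, ‖φ i‖ ^ 2 : ℝ) : ℂ) := by
  push_cast
  exact Finset.sum_congr rfl fun i _ => by
    rw [← Complex.conj_mul']; rfl

theorem Matrix.unitaryGroup.sum_star_mulVec_mul_mulVec [DecidableEq β]
    (U : Matrix.unitaryGroup β ℂ) (φ ψ : β → ℂ) :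
    ∑ i, star (Matrix.mulVec U.1 φ i) * Matrix.mulVec U.1 ψ i = ∑ i, star (φ i) * ψ i := by
  have h : star (Matrix.mulVec U.1 φ) ⬝ᵥ Matrix.mulVec U.1 ψ = star φ ⬝ᵥ ψ := by
    rw [Matrix.star_mulVec, Matrix.dotProduct_mulVec, Matrix.vecMul_vecMul,
      ← Matrix.star_eq_conjTranspose, Matrix.UnitaryGroup.star_mul_self, Matrix.vecMul_one]
  exact h

/-- Two states that a measurement distinguishes with error at most `1 / 3` are far from
parallel. -/
theorem norm_sum_star_mul_le_of_distinguished (φ ψ : β → ℂ) (s : Finset β)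
    (hφ : ∑ i, ‖φ i‖ ^ 2 = 1) (hψ : ∑ i, ‖ψ i‖ ^ 2 = 1)
    (hφs : 2 / 3 ≤ ∑ i ∈ s, ‖φ i‖ ^ 2) (hψs : ∑ i ∈ s, ‖ψ i‖ ^ 2 ≤ 1 / 3) :
    ‖∑ i, star (φ i) * ψ i‖ ≤ 17 / 18 := by
  classical
  rw [← Finset.sum_add_sum_compl s] at hφ hψ ⊢
  -- The ratio 3/2 is a rational stand-in for the optimal √2; the two bounds add up to 6 · 17/18.
  have h1 := norm_sum_star_mul_le s φ ψ 2 3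
  have h2 := norm_sum_star_mul_le sᶜ φ ψ 3 2
  have h3 := norm_add_le (∑ i ∈ s, star (φ i) * ψ i) (∑ i ∈ sᶜ, star (φ i) * ψ i)
  linarith

end UnitaryEvolution

/-! ### Query weights and the adversary bound -/

section QuantumQuery

variable {ι A O : Type} [Fintype ι] [Fintype A]

/-- The total weight of the amplitudes of the basis states with index register `i`. -/
noncomputable def queryWeight [DecidableEq ι] {d : ℕ} (ψ : ι × A × Fin d → ℂ) (i : ι) : ℝ :=
  ∑ b with b.1 = i, ‖ψ b‖ ^ 2

theorem sum_queryWeight [DecidableEq ι] {d : ℕ} (ψ : ι × A × Fin d → ℂ) :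
    ∑ i, queryWeight ψ i = ∑ b, ‖ψ b‖ ^ 2 :=
  Finset.sum_fiberwise _ _ _

theorem queryWeight_nonneg [DecidableEq ι] {d : ℕ} (ψ : ι × A × Fin d → ℂ) (i : ι) :
    0 ≤ queryWeight ψ i :=
  Finset.sum_nonneg fun _ _ => by positivity

variable [AddCommGroup A]

/-- The permutation of the computational basis that underlies `quantumQuery x`. -/
def quantumQueryEquiv {ι A : Type} [AddCommGroup A] (x : ι → A) (d : ℕ) :
    ι × A × Fin d ≃ ι × A × Fin d where
  toFun b := (b.1, b.2.1 - x b.1, b.2.2)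
  invFun b := (b.1, b.2.1 + x b.1, b.2.2)
  left_inv b := by simp
  right_inv b := by simp

theorem sum_quantumQuery_filter {M : Type} [AddCommMonoid M] {d : ℕ} (x : ι → A)
    (g : ι × A × Fin d → M) (p : ι → Prop) [DecidablePred p] :
    ∑ b : ι × A × Fin d with p b.1, g (b.1, b.2.1 - x b.1, b.2.2) =
      ∑ b : ι × A × Fin d with p b.1, g b := by
  rw [Finset.sum_filter, Finset.sum_filter]
  exact (quantumQueryEquiv x d).sum_comp fun b => if p b.1 then g b else 0

theorem sum_norm_sq_quantumQuery {d : ℕ} (x : ι → A) (ψ : ι × A × Fin d → ℂ) :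
    ∑ b, ‖quantumQuery x ψ b‖ ^ 2 = ∑ b, ‖ψ b‖ ^ 2 :=
  (quantumQueryEquiv x d).sum_comp fun b => ‖ψ b‖ ^ 2

theorem queryWeight_quantumQuery [DecidableEq ι] {d : ℕ} (x : ι → A) (ψ : ι × A × Fin d → ℂ)
    (i : ι) : queryWeight (quantumQuery x ψ) i = queryWeight ψ i :=
  sum_quantumQuery_filter x (fun b => ‖ψ b‖ ^ 2) (· = i)

variable [DecidableEq ι]

/-- A query to inputs that differ only at `i` changes the inner product of two states by an amount
controlled by the query weights at `i`. -/
theorem norm_inner_quantumQuery_sub_le {d : ℕ} {x y : ι → A} {i : ι}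
    (hxy : ∀ k, k ≠ i → x k = y k) (φ ψ : ι × A × Fin d → ℂ) {a b : ℝ}
    (hab : 0 ≤ a * b) :
    a * b * ‖∑ c, star (quantumQuery x φ c) * quantumQuery y ψ c - ∑ c, star (φ c) * ψ c‖ ≤
      a ^ 2 * queryWeight φ i + b ^ 2 * queryWeight ψ i := by
  -- Away from index `i` both queries permute the basis identically, so only the block at `i` can
  -- change the inner product.
  have hne : ∑ c : ι × A × Fin d with ¬ c.1 = i, star (quantumQuery x φ c) * quantumQuery y ψ c =
      ∑ c : ι × A × Fin d with ¬ c.1 = i, star (φ c) * ψ c := by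
    rw [← sum_quantumQuery_filter x (fun c => star (φ c) * ψ c) (fun k => ¬ k = i)]
    refine Finset.sum_congr rfl fun c hc => ?_
    simp only [Finset.mem_filter, Finset.mem_univ, true_and] at hc
    simp only [quantumQuery, hxy _ hc]
  have h1 := norm_sum_star_mul_le {c | c.1 = i} (quantumQuery x φ) (quantumQuery y ψ) a b
  have h2 := norm_sum_star_mul_le {c | c.1 = i} φ ψ a b
  have e1 := queryWeight_quantumQuery x φ i
  have e2 := queryWeight_quantumQuery y ψ i
  rw [← Finset.sum_filter_add_sum_filter_not _ (fun c : ι × A × Fin d => c.1 = i),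
    ← Finset.sum_filter_add_sum_filter_not Finset.univ (fun c : ι × A × Fin d => c.1 = i)
      (fun c => star (φ c) * ψ c), hne, add_sub_add_right_eq_sub]
  have h3 := mul_le_mul_of_nonneg_left (norm_sub_le
    (∑ c : ι × A × Fin d with c.1 = i, star (quantumQuery x φ c) * quantumQuery y ψ c)
    (∑ c : ι × A × Fin d with c.1 = i, star (φ c) * ψ c)) hab
  unfold queryWeight at *
  rw [e1, e2] at h1
  linarith

namespace QuantumAlgorithm

variable [DecidableEq A] (Q : QuantumAlgorithm ι A O)

theorem sum_norm_sq_state (x : ι → A) (k : ℕ) : ∑ b, ‖Q.state x k b‖ ^ 2 = 1 := by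
  have hU (U : Matrix.unitaryGroup (ι × A × Fin Q.d) ℂ) (φ : ι × A × Fin Q.d → ℂ) :
      ∑ b, ‖Matrix.mulVec U.1 φ b‖ ^ 2 = ∑ b, ‖φ b‖ ^ 2 := by
    have := Matrix.unitaryGroup.sum_star_mulVec_mul_mulVec U φ φ
    rw [sum_star_mul_self_eq, sum_star_mul_self_eq] at this
    exact_mod_cast this
  induction k with
  | zero =>
    rw [state, hU, Finset.sum_eq_single Q.start] <;> simp +contextual
  | succ k ih => rw [state, hU, sum_norm_sq_quantumQuery, ih]

theorem inner_state_zero (x y : ι → A) :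
    ∑ b, star (Q.state x 0 b) * Q.state y 0 b = 1 := by
  have h := sum_star_mul_self_eq (Q.state x 0)
  rw [sum_norm_sq_state] at h
  exact_mod_cast h

/-- The inner product starts at 1, unitaries preserve it, and each query moves it by at most the
weighted query weights at `i`. -/
theorem norm_inner_state_sub_le {x y : ι → A} {i : ι} (hxy : ∀ k, k ≠ i → x k = y k)
    {a b : ℝ} (hab : 0 ≤ a * b) (T : ℕ) :
    a * b * (1 - ‖∑ c, star (Q.state x T c) * Q.state y T c‖) ≤
      ∑ k ∈ Finset.range T,
        (a ^ 2 * queryWeight (Q.state x k) i + b ^ 2 * queryWeight (Q.state y k) i) := by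
  induction T with
  | zero => rw [inner_state_zero]; simp
  | succ T ih =>
    rw [Finset.sum_range_succ]
    have h := norm_inner_quantumQuery_sub_le hxy (Q.state x T) (Q.state y T) hab
    have hU := Matrix.unitaryGroup.sum_star_mulVec_mul_mulVec (Q.unitary (T + 1))
      (quantumQuery x (Q.state x T)) (quantumQuery y (Q.state y T))
    rw [show Q.state x (T + 1) = Matrix.mulVec (Q.unitary (T + 1)).1
      (quantumQuery x (Q.state x T)) from rfl, show Q.state y (T + 1) = Matrix.mulVec
      (Q.unitary (T + 1)).1 (quantumQuery y (Q.state y T)) from rfl, hU]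
    have h3 := mul_le_mul_of_nonneg_left (norm_sub_norm_le (∑ c, star (Q.state x T c) *
      Q.state y T c) (∑ c, star (quantumQuery x (Q.state x T) c) *
        quantumQuery y (Q.state y T) c)) hab
    rw [norm_sub_rev] at h3
    linarith

theorem norm_inner_state_numQueries_le {f : (ι → A) → O} (hf : Q.Computes f) {x y : ι → A}
    (hxy : f x ≠ f y) :
    ‖∑ c, star (Q.state x Q.numQueries c) * Q.state y Q.numQueries c‖ ≤ 17 / 18 := by
  classical
  have hx := hf x
  have hy := hf y
  unfold outputProb at hx hy
  rw [← Finset.sum_filter] at hx hy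
  refine norm_sum_star_mul_le_of_distinguished _ _ {b | Q.decode b = f x}
    (Q.sum_norm_sq_state x _) (Q.sum_norm_sq_state y _) (by convert hx) ?_
  have h1 := Q.sum_norm_sq_state y Q.numQueries
  rw [← Finset.sum_filter_add_sum_filter_not _ (fun b => Q.decode b = f x)] at h1
  have h2 : ∑ b with Q.decode b = f y, ‖Q.state y Q.numQueries b‖ ^ 2 ≤
      ∑ b with ¬ Q.decode b = f x, ‖Q.state y Q.numQueries b‖ ^ 2 := by
    refine Finset.sum_le_sum_of_subset_of_nonneg (fun b hb => ?_) fun _ _ _ => by positivity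
    simp only [Finset.mem_filter, Finset.mem_univ, true_and] at hb ⊢
    rw [hb]
    exact hxy.symm
  have h3 : 2 / 3 ≤ ∑ b with Q.decode b = f y, ‖Q.state y Q.numQueries b‖ ^ 2 := by
    convert hy
  linarith

/-- The adversary bound for a weighted graph on a family of inputs, every edge of which joins two
inputs with different values of `f` that differ at a single position. -/
theorem adversary_bound {f : (ι → A) → O} (hf : Q.Computes f) {V E : Type} [Fintype V]
    (edges : Finset E) (X : V → ι → A) (u v : E → V) (pos : E → ι) (a : V → ℝ)
    (ha : ∀ v, 0 ≤ a v) (hX : ∀ e ∈ edges, ∀ k, k ≠ pos e → X (u e) k = X (v e) k)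
    (hfX : ∀ e ∈ edges, f (X (u e)) ≠ f (X (v e)))
    (hu : ∀ e ∈ edges, ∀ e' ∈ edges, u e = u e' → pos e = pos e' → e = e')
    (hv : ∀ e ∈ edges, ∀ e' ∈ edges, v e = v e' → pos e = pos e' → e = e')
    (huv : ∀ e ∈ edges, ∀ e' ∈ edges, u e = v e' → pos e ≠ pos e') :
    ∑ e ∈ edges, a (u e) * a (v e) ≤ 18 * (Q.numQueries * ∑ v, a v ^ 2) := by
  classical
  -- Each pair (vertex, position) occurs at most once among all edge ends, and the query weights of
  -- a state sum to 1.
  have hstep (k : ℕ) : ∑ e ∈ edges, (a (u e) ^ 2 * queryWeight (Q.state (X (u e)) k) (pos e) +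
      a (v e) ^ 2 * queryWeight (Q.state (X (v e)) k) (pos e)) ≤ ∑ v, a v ^ 2 := by
    set g : V × ι → ℝ := fun p => a p.1 ^ 2 * queryWeight (Q.state (X p.1) k) p.2 with hg
    have hiu : Set.InjOn (fun e => (u e, pos e)) edges := fun e he e' he' h =>
      hu e he e' he' (Prod.ext_iff.1 h).1 (Prod.ext_iff.1 h).2
    have hiv : Set.InjOn (fun e => (v e, pos e)) edges := fun e he e' he' h =>
      hv e he e' he' (Prod.ext_iff.1 h).1 (Prod.ext_iff.1 h).2
    have hdisj : Disjoint (edges.image fun e => (u e, pos e))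
        (edges.image fun e => (v e, pos e)) := by
      rw [Finset.disjoint_left]
      rintro p hp hp'
      obtain ⟨e, he, rfl⟩ := Finset.mem_image.1 hp
      obtain ⟨e', he', h⟩ := Finset.mem_image.1 hp'
      exact huv e he e' he' (Prod.ext_iff.1 h).1.symm (Prod.ext_iff.1 h).2.symm
    calc _ = ∑ p ∈ (edges.image fun e => (u e, pos e)) ∪
          (edges.image fun e => (v e, pos e)), g p := by
          rw [Finset.sum_union hdisj, Finset.sum_image hiu, Finset.sum_image hiv,
            Finset.sum_add_distrib]
      _ ≤ ∑ p, g p := Finset.sum_le_univ_sum_of_nonneg fun p =>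
          mul_nonneg (sq_nonneg _) (queryWeight_nonneg _ _)
      _ = ∑ v, a v ^ 2 := by
          rw [Fintype.sum_prod_type]
          refine Finset.sum_congr rfl fun v _ => ?_
          simp only [hg]
          rw [← Finset.mul_sum, sum_queryWeight, sum_norm_sq_state, mul_one]
  -- The factor 18 is the inverse of the required drop 1 - 17/18.
  have hedge : ∀ e ∈ edges, a (u e) * a (v e) ≤ 18 * ∑ k ∈ Finset.range Q.numQueries,
      (a (u e) ^ 2 * queryWeight (Q.state (X (u e)) k) (pos e) +
        a (v e) ^ 2 * queryWeight (Q.state (X (v e)) k) (pos e)) := by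
    intro e he
    have hab := mul_nonneg (ha (u e)) (ha (v e))
    have h1 := Q.norm_inner_state_sub_le (hX e he) hab Q.numQueries
    have h2 := mul_le_mul_of_nonneg_left
      (Q.norm_inner_state_numQueries_le hf (hfX e he)) hab
    linarith
  refine (Finset.sum_le_sum hedge).trans ?_
  rw [← Finset.mul_sum, Finset.sum_comm]
  gcongr
  exact (Finset.sum_le_sum fun k _ => hstep k).trans_eq (by simp)

end QuantumAlgorithm

end QuantumQuery

/-! ### Direct product of search problems -/

/-- The sum factors over blocks; in each, `none` and all marked choices together contribute 1
apiece. -/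
theorem sum_prod_option_weight {J : Type} [Fintype J] [DecidableEq J] {K : J → Type}
    [∀ j, Fintype (K j)] [∀ j, Nonempty (K j)] (w : ∀ j, Option (K j) → ℝ)
    (h : ∀ j, w j none = 1) (h' : ∀ j p, w j (some p) = 1 / Fintype.card (K j)) :
    ∑ c : ∀ j, Option (K j), ∏ j, w j (c j) = 2 ^ Fintype.card J := by
  rw [← Fintype.prod_sum]
  have (j : J) : ∑ o, w j o = 2 := by
    simp only [Fintype.sum_option, h, h', Finset.sum_const, Finset.card_univ, nsmul_eq_mul]
    field_simp
    norm_num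
  simp [this]

/-- Fixing block `i` to `none` replaces its factor 2 by 1. -/
theorem sum_filter_none_prod_option_weight {J : Type} [Fintype J] [DecidableEq J]
    {K : J → Type} [∀ j, Fintype (K j)] [∀ j, Nonempty (K j)] (w : ∀ j, Option (K j) → ℝ)
    (h : ∀ j, w j none = 1) (h' : ∀ j p, w j (some p) = 1 / Fintype.card (K j)) (i : J) :
    2 * ∑ c : ∀ j, Option (K j) with c i = none, ∏ j, w j (c j) = 2 ^ Fintype.card J := by
  classical
  have hs : (Finset.univ.filter fun c : ∀ j, Option (K j) => c i = none) =
      Fintype.piFinset (Function.update (fun _ => Finset.univ) i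
        ({none} : Finset (Option (K i)))) := by
    ext c
    simp only [Finset.mem_filter, Finset.mem_univ, true_and, Fintype.mem_piFinset]
    constructor
    · intro hc j
      by_cases hj : j = i
      · subst hj; simp [hc]
      · simp [Function.update_of_ne hj]
    · intro hc
      simpa using hc i
  rw [hs, ← Finset.prod_univ_sum, ← sum_prod_option_weight w h h', ← Fintype.prod_sum,
    ← Finset.mul_prod_erase _ _ (Finset.mem_univ i),
    ← Finset.mul_prod_erase _ (fun j => ∑ o, w j o) (Finset.mem_univ i), ← mul_assoc]
  congr 1
  · simp only [Function.update_self, Finset.sum_singleton, Fintype.sum_option, h, h',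
      Finset.sum_const, Finset.card_univ, nsmul_eq_mul]
    field_simp
    norm_num
  · refine Finset.prod_congr rfl fun j hj => ?_
    rw [Function.update_of_ne (Finset.ne_of_mem_erase hj)]

/-- The direct product of search problems: an algorithm that detects in each of the blocks `j`
whether one of the positions in `K j` is marked makes `Ω(∑ j, √|K j|)` queries. -/
theorem QuantumAlgorithm.sum_sqrt_card_le {ι A O : Type} [Fintype ι] [DecidableEq ι] [Fintype A]
    [DecidableEq A] [AddCommGroup A] (Q : QuantumAlgorithm ι A O) {f : (ι → A) → O}
    (hf : Q.Computes f) {J : Type} [Fintype J] [DecidableEq J] {K : J → Type}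
    [∀ j, Fintype (K j)] [∀ j, Nonempty (K j)] (X : (∀ j, Option (K j)) → ι → A)
    (pos : (Σ j, K j) → ι) (hpos : Function.Injective pos)
    (hX : ∀ c j p, c j = none → ∀ k, k ≠ pos ⟨j, p⟩ →
      X c k = X (Function.update c j (some p)) k)
    (hfX : ∀ c j p, c j = none → f (X c) ≠ f (X (Function.update c j (some p)))) :
    ∑ j, √(Fintype.card (K j) : ℝ) ≤ 36 * Q.numQueries := by
  classical
  -- The weight `1 / √|K j|` gives the unmarked state and all marked states of a block equal squared
  -- mass; the `|K j|` edges leaving `c` in block `j` then total `a c ^ 2 * √|K j|`.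
  set w : ∀ j, Option (K j) → ℝ := fun j o => o.elim 1 fun _ => 1 / √(Fintype.card (K j) : ℝ)
    with hw
  set a : (∀ j, Option (K j)) → ℝ := fun c => ∏ j, w j (c j)
  have hw0 : ∀ j o, 0 ≤ w j o := by
    rintro j (_ | p) <;> simp [hw]
  have hsq : ∀ c, a c ^ 2 = ∏ j, w j (c j) ^ 2 := fun c => (Finset.prod_pow _ _ _).symm
  have hnone : ∀ j, w j none ^ 2 = 1 := fun j => by simp [hw]
  have hsome : ∀ j p, w j (some p) ^ 2 = 1 / Fintype.card (K j) := fun j p => by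
    simp [hw, Real.sq_sqrt]
  have hupd : ∀ c j p, c j = none →
      a c * a (Function.update c j (some p)) = a c ^ 2 / √(Fintype.card (K j) : ℝ) := by
    intro c j p hc
    have h1 : a c = ∏ k ∈ Finset.univ.erase j, w k (c k) := by
      rw [show a = fun c => ∏ j, w j (c j) from rfl]
      dsimp only
      rw [← Finset.mul_prod_erase _ _ (Finset.mem_univ j), hc]
      simp [hw]
    have h2 : a (Function.update c j (some p)) =
        1 / √(Fintype.card (K j) : ℝ) * ∏ k ∈ Finset.univ.erase j, w k (c k) := by
      rw [show a = fun c => ∏ j, w j (c j) from rfl]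
      dsimp only
      rw [← Finset.mul_prod_erase _ _ (Finset.mem_univ j)]
      congr 1
      · simp [hw]
      · exact Finset.prod_congr rfl fun k hk => by
          rw [Function.update_of_ne (Finset.ne_of_mem_erase hk)]
    rw [h2, ← h1]
    ring
  have hback : ∀ (c : ∀ j, Option (K j)) j p, c j = none →
      Function.update (Function.update c j (some p)) j none = c := by
    intro c j p hc
    rw [Function.update_idem, ← hc, Function.update_eq_self]
  -- An edge plants one mark in an empty block. Its position determines the block, which is empty at
  -- the `u` end and marked at the `v` end, so no (vertex, position) pair repeats.
  have key := Q.adversary_bound hf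
    (E := (∀ j, Option (K j)) × Σ j, K j)
    (edges := {e | e.1 e.2.1 = none}) (X := X) (u := fun e => e.1)
    (v := fun e => Function.update e.1 e.2.1 (some e.2.2)) (pos := fun e => pos e.2) (a := a)
    (fun c => Finset.prod_nonneg fun j _ => hw0 j _)
    (fun e he => hX e.1 e.2.1 e.2.2 (by simpa using he))
    (fun e he => hfX e.1 e.2.1 e.2.2 (by simpa using he))
    (fun e _ e' _ h h' => Prod.ext h (hpos h'))
    (by
      rintro ⟨c, j, p⟩ he ⟨c', j', p'⟩ he' h h'
      cases hpos h'
      simp only [Finset.mem_filter, Finset.mem_univ, true_and] at he he' h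
      rw [← hback c j p he, h, hback c' j p he'])
    (by
      rintro ⟨c, j, p⟩ he ⟨c', j', p'⟩ he' h h'
      cases hpos h'
      simp only [Finset.mem_filter, Finset.mem_univ, true_and] at he h
      rw [h] at he
      simp at he)
  have hleft : ∑ e : (∀ j, Option (K j)) × Σ j, K j with e.1 e.2.1 = none,
      a e.1 * a (Function.update e.1 e.2.1 (some e.2.2)) =
      2 ^ Fintype.card J / 2 * ∑ j, √(Fintype.card (K j) : ℝ) := by
    have h1 : ∀ j, ∑ c : ∀ j, Option (K j) with c j = none, a c ^ 2 =
        2 ^ Fintype.card J / 2 := by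
      intro j
      simp only [hsq]
      rw [← sum_filter_none_prod_option_weight (fun j o => w j o ^ 2) hnone hsome j]
      ring
    rw [Finset.sum_filter, Fintype.sum_prod_type_right, Fintype.sum_sigma, Finset.mul_sum]
    refine Finset.sum_congr rfl fun j _ => ?_
    have h2 : ∀ p : K j, ∑ c : ∀ j, Option (K j), (if c j = none then
        a c * a (Function.update c j (some p)) else 0) =
        2 ^ Fintype.card J / 2 / √(Fintype.card (K j) : ℝ) := by
      intro p
      rw [← h1 j, Finset.sum_div, Finset.sum_filter]
      refine Finset.sum_congr rfl fun c _ => ?_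
      split_ifs with hc
      · exact hupd c j p hc
      · rfl
    simp only [h2, Finset.sum_const, Finset.card_univ, nsmul_eq_mul]
    rw [mul_comm, div_mul_eq_mul_div, mul_div_assoc, Real.div_sqrt]
  have hright : ∑ c, a c ^ 2 = 2 ^ Fintype.card J := by
    simp only [hsq]
    exact sum_prod_option_weight (fun j o => w j o ^ 2) hnone hsome
  rw [hleft, hright] at key
  have h2 : (0 : ℝ) < 2 ^ Fintype.card J := by positivity
  refine le_of_mul_le_mul_left ?_ h2
  linarith

/-! ### Hard instances of string matching -/

section StringMatching

theorem exists_balanced_lengths {n m L : ℕ} (hm : 1 ≤ m) (hmL : m ≤ L) (hL : L ≤ m * n) :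
    ∃ len : Fin m → ℕ, (∀ j, 1 ≤ len j) ∧ ∑ j, len j = L ∧ (∀ j, len j ≤ n) ∧
      ∀ j, L / m ≤ len j := by
  have hd : 1 ≤ L / m := Nat.div_pos hmL hm
  have hdiv := Nat.div_add_mod L m
  have hmod := Nat.mod_lt L hm
  refine ⟨fun j => L / m + if (j : ℕ) < L % m then 1 else 0, fun j => le_add_right hd,
    ?_, fun j => ?_, fun j => Nat.le_add_right _ _⟩
  · rw [Finset.sum_add_distrib, Finset.sum_const, Finset.card_univ, Fintype.card_fin,
      smul_eq_mul, Finset.sum_boole, Fin.card_filter_val_lt, min_eq_right hmod.le]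
    exact_mod_cast hdiv
  -- If `L / m = n`, then `L ≤ m * n` leaves no remainder to distribute.
  · have h1 : L / m ≤ n := Nat.div_le_of_le_mul hL
    rcases h1.lt_or_eq with h | h
    · dsimp only; split_ifs <;> omega
    · rw [h] at hdiv
      dsimp only; rw [if_neg (by omega), h, add_zero]

/-- The last string absorbs the excess length, possibly beyond `n`, which does no harm to the text
bound. For `m = 1` string 0 is itself the last one, hence `L = 1`. -/
theorem exists_lengths_with_singleton {m L : ℕ} (hm : 1 ≤ m) (hmL : m ≤ L)
    (h : 2 ≤ m ∨ L = 1) :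
    ∃ len : Fin m → ℕ, (∀ j, 1 ≤ len j) ∧ ∑ j, len j = L ∧ ∃ j, len j = 1 := by
  obtain ⟨m, rfl⟩ := Nat.exists_eq_add_of_le' hm
  refine ⟨fun j => 1 + if j = Fin.last m then L - (m + 1) else 0, fun j => Nat.le_add_right _ _,
    ?_, 0, ?_⟩
  · rw [Finset.sum_add_distrib]
    simp
    omega
  · by_cases h0 : (0 : Fin (m + 1)) = Fin.last m
    · have : m = 0 := by simpa using (congrArg Fin.val h0).symm
      simp only [if_pos h0]
      omega
    · simp [h0]

variable {A : Type} {n m : ℕ} {len : Fin m → ℕ}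

theorem mem_multipleStringMatching_of_forall_eq (x : MSMIndex n len → A) (a : A) (j : Fin m)
    (ht : ∀ i, x (Sum.inl i) = a) (hs : ∀ k, x (Sum.inr ⟨j, k⟩) = a) {i : Fin n}
    (hi : i + len j ≤ n) : i ∈ multipleStringMatching n len x j :=
  fun k => ⟨by have := k.2; omega, by rw [ht, hs]⟩

theorem notMem_multipleStringMatching (x : MSMIndex n len → A) {j : Fin m} {i i' : Fin n}
    (k : Fin (len j)) (hi' : (i' : ℕ) = i + k)
    (h : x (Sum.inl i') ≠ x (Sum.inr ⟨j, k⟩)) : i ∉ multipleStringMatching n len x j := by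
  intro hi
  obtain ⟨hn, he⟩ := hi k
  exact h (by rw [← he]; congr 2; exact Fin.ext hi')

/-- Changing any one symbol of the all-zero instance changes the set of occurrences. -/
theorem multipleStringMatching_zero_ne_update [Zero A] {a : A} (ha : a ≠ 0) (hm : 1 ≤ m)
    (hlen : ∀ j, 1 ≤ len j) (hlen' : ∀ j, len j ≤ n) (i : MSMIndex n len) :
    multipleStringMatching n len (0 : MSMIndex n len → A) ≠
      multipleStringMatching n len (Function.update 0 i a) := by
  intro h
  rcases i with i | ⟨j, k⟩
  · let j : Fin m := ⟨0, hm⟩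
    have h1 := hlen j
    have h2 := hlen' j
    have h3 := i.2
    -- This start keeps the window inside the text and makes it cover `i`.
    let s : Fin n := ⟨min i (n - len j), by omega⟩
    have hs : s ∈ multipleStringMatching n len (0 : MSMIndex n len → A) j :=
      mem_multipleStringMatching_of_forall_eq _ 0 j (fun _ => rfl) (fun _ => rfl)
        (by simp only [s]; omega)
    rw [h] at hs
    refine notMem_multipleStringMatching _ (i' := i) ⟨i - s, by simp only [s]; omega⟩
      (by simp only [s]; omega) ?_ hs
    simpa using ha
  · have h2 := hlen' j
    have h3 := hlen j
    let s : Fin n := ⟨0, by omega⟩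
    have hs : s ∈ multipleStringMatching n len (0 : MSMIndex n len → A) j :=
      mem_multipleStringMatching_of_forall_eq _ 0 j (fun _ => rfl) (fun _ => rfl)
        (by simp only [s]; omega)
    rw [h] at hs
    refine notMem_multipleStringMatching _ (i' := ⟨k, by omega⟩) k (by simp [s]) ?_ hs
    simpa using ha.symm

theorem card_MSMIndex (n : ℕ) {m : ℕ} (len : Fin m → ℕ) :
    Fintype.card (MSMIndex n len) = n + ∑ j, len j := by
  simp [MSMIndex]

theorem randomized_msm_lower_bound [Zero A] [Nontrivial A] (hm : 1 ≤ m)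
    (hlen : ∀ j, 1 ≤ len j) (hlen' : ∀ j, len j ≤ n)
    (R : RandomizedAlgorithm (MSMIndex n len) A (Fin m → Set (Fin n))) {T : ℕ}
    (hR : R.Computes (multipleStringMatching n len)) (hT : R.QueriesAtMost T) :
    ((n + ∑ j, len j : ℕ) : ℝ) ≤ 3 * T := by
  obtain ⟨a, ha⟩ := exists_ne (0 : A)
  rw [← card_MSMIndex]
  exact R.card_le_of_sensitive hR hT 0 (fun i => Function.update 0 i a)
    (fun i k hk => by simp [hk])
    fun i => multipleStringMatching_zero_ne_update ha hm hlen hlen' i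

variable [Fintype A] [DecidableEq A] [AddCommGroup A] [Nontrivial A]

/-- Finding out which dictionary strings equal the all-zero substrings of an all-zero text. -/
theorem quantum_msm_dictionary_lower_bound (hlen : ∀ j, 1 ≤ len j) (hlen' : ∀ j, len j ≤ n)
    (Q : QuantumAlgorithm (MSMIndex n len) A (Fin m → Set (Fin n)))
    (hQ : Q.Computes (multipleStringMatching n len)) :
    ∑ j, √(len j : ℝ) ≤ 36 * Q.numQueries := by
  obtain ⟨a, ha⟩ := exists_ne (0 : A)
  have (j : Fin m) : Nonempty (Fin (len j)) := ⟨⟨0, hlen j⟩⟩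
  -- A mark is a nonzero symbol planted in string `j`; it removes the occurrence at position 0.
  have key := Q.sum_sqrt_card_le hQ (J := Fin m) (K := fun j => Fin (len j))
    (fun c i => i.elim (fun _ => 0) fun p => if c p.1 = some p.2 then a else 0) Sum.inr
    Sum.inr_injective ?_ ?_
  · simpa using key
  · rintro c j p hc (i | ⟨j', k⟩) hk
    · rfl
    · by_cases hj : j' = j
      · subst hj
        have hkp : p ≠ k := by rintro rfl; exact hk rfl
        simp [hc, hkp]
      · simp [Function.update_of_ne hj]
  · intro c j p hc h
    have h2 := hlen' j
    have h3 := hlen j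
    let s : Fin n := ⟨0, by omega⟩
    have hs := mem_multipleStringMatching_of_forall_eq (n := n) (len := len)
      (fun i => i.elim (fun _ => 0) fun p => if c p.1 = some p.2 then a else 0) 0 j
      (fun _ => rfl) (fun k => by simp [hc]) (i := s) (by simp only [s]; omega)
    rw [h] at hs
    refine notMem_multipleStringMatching _ (i' := ⟨p, by omega⟩) p (by simp [s]) ?_ hs
    simpa using ha.symm

/-- Finding all the occurrences of a single symbol in a text over two symbols. -/
theorem quantum_msm_text_lower_bound {j : Fin m} (hj : len j = 1)
    (Q : QuantumAlgorithm (MSMIndex n len) A (Fin m → Set (Fin n)))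
    (hQ : Q.Computes (multipleStringMatching n len)) : (n : ℝ) ≤ 36 * Q.numQueries := by
  obtain ⟨a, ha⟩ := exists_ne (0 : A)
  -- String `j` is the single symbol 0, so its occurrences are exactly the unmarked text positions.
  have key := Q.sum_sqrt_card_le hQ (J := Fin n) (K := fun _ => Unit)
    (fun c i => i.elim (fun i => if c i = none then 0 else a) fun _ => 0)
    (fun p => Sum.inl p.1) (fun p p' h => Sigma.ext (Sum.inl_injective h) (by simp)) ?_ ?_
  · simpa using key
  · rintro c i p hc (i' | k) hk
    · have hi : i' ≠ i := by rintro rfl; exact hk rfl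
      simp [Function.update_of_ne hi]
    · rfl
  · intro c i p hc h
    have hs : i ∈ multipleStringMatching n len
        (fun i => i.elim (fun i => if c i = none then 0 else a) fun _ => 0) j := by
      intro k
      have hk : (k : ℕ) = 0 := by omega
      simp [hk, hc]
    rw [h] at hs
    refine notMem_multipleStringMatching _ (i' := i) ⟨0, by omega⟩ (by simp) ?_ hs
    simpa using ha

end StringMatching

/-! ### Constants and conclusion -/

theorem sqrt_mul_le_two_mul_sum_sqrt {m L : ℕ} (hm : 1 ≤ m) (hmL : m ≤ L) {len : Fin m → ℕ}
    (hlen : ∀ j, L / m ≤ len j) : √((m : ℝ) * L) ≤ 2 * ∑ j, √(len j : ℝ) := by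
  have h1 : (m : ℝ) * √((L / m : ℕ) : ℝ) ≤ ∑ j, √(len j : ℝ) := by
    calc (m : ℝ) * √((L / m : ℕ) : ℝ) = ∑ _j : Fin m, √((L / m : ℕ) : ℝ) := by simp
      _ ≤ _ := Finset.sum_le_sum fun j _ => Real.sqrt_le_sqrt (by exact_mod_cast hlen j)
  -- Rounding down loses less than a factor 2, as `L / m ≥ 1`; 4 is used for its integral square
  -- root.
  have h2 : L ≤ 4 * (m * (L / m)) := by
    have hd : 1 ≤ L / m := Nat.div_pos hmL hm
    have hdiv := Nat.div_add_mod L m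
    have hmod := Nat.mod_lt L hm
    nlinarith
  have h3 : √((m : ℝ) * L) ≤ 2 * (m * √((L / m : ℕ) : ℝ)) := by
    refine Real.sqrt_le_iff.2 ⟨by positivity, ?_⟩
    have h4 : (L : ℝ) ≤ 4 * (m * ((L / m : ℕ) : ℝ)) := by exact_mod_cast h2
    rw [mul_pow, mul_pow, Real.sq_sqrt (Nat.cast_nonneg _)]
    have := mul_le_mul_of_nonneg_left h4 (Nat.cast_nonneg (α := ℝ) m)
    linarith
  linarith

theorem mainTheorem2 :
    (∃ c : ℝ, 0 < c ∧ ∀ (q n m L : ℕ) [NeZero q], 2 ≤ q → 1 ≤ m → m ≤ L → L ≤ m * n →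
      ∃ len : Fin m → ℕ, (∀ j, 1 ≤ len j) ∧ ∑ j, len j = L ∧
        ∀ (R : RandomizedAlgorithm (MSMIndex n len) (ZMod q) (Fin m → Set (Fin n))) (T : ℕ),
          R.Computes (multipleStringMatching n len) → R.QueriesAtMost T →
            c * ((n : ℝ) + (L : ℝ)) ≤ (T : ℝ)) ∧
    (∃ c : ℝ, 0 < c ∧ ∀ (q n m L : ℕ) [NeZero q], 2 ≤ q → 1 ≤ m → m ≤ L → L ≤ m * n →
      (2 ≤ m ∨ L = 1) →
      ∃ len : Fin m → ℕ, (∀ j, 1 ≤ len j) ∧ ∑ j, len j = L ∧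
        ∀ Q : QuantumAlgorithm (MSMIndex n len) (ZMod q) (Fin m → Set (Fin n)),
          Q.Computes (multipleStringMatching n len) →
            c * ((n : ℝ) + Real.sqrt ((m : ℝ) * (L : ℝ))) ≤ (Q.numQueries : ℝ)) := by
  constructor
  · refine ⟨1 / 3, by norm_num, fun q n m L _ hq hm hmL hL => ?_⟩
    have : Fact (1 < q) := ⟨hq⟩
    obtain ⟨len, hlen, hsum, hlen', -⟩ := exists_balanced_lengths hm hmL hL
    refine ⟨len, hlen, hsum, fun R T hR hT => ?_⟩
    have h := randomized_msm_lower_bound hm hlen hlen' R hR hT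
    rw [hsum] at h
    push_cast at h
    linarith
  · refine ⟨1 / 144, by norm_num, fun q n m L _ hq hm hmL hL h2 => ?_⟩
    have : Fact (1 < q) := ⟨hq⟩
    -- Bounding the sum by twice its larger term costs 2; with the 2 from rounding and the 36, this
    -- gives 144.
    rcases le_total (n : ℝ) √((m : ℝ) * L) with hn | hn
    · obtain ⟨len, hlen, hsum, hlen', hdiv⟩ := exists_balanced_lengths hm hmL hL
      refine ⟨len, hlen, hsum, fun Q hQ => ?_⟩
      have h3 := quantum_msm_dictionary_lower_bound hlen hlen' Q hQ
      have h4 := sqrt_mul_le_two_mul_sum_sqrt hm hmL hdiv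
      linarith
    · obtain ⟨len, hlen, hsum, j, hj⟩ := exists_lengths_with_singleton hm hmL h2
      refine ⟨len, hlen, hsum, fun Q hQ => ?_⟩
      have h3 := quantum_msm_text_lower_bound hj Q hQ
      linarith
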